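/- Let $\omega_1,\dots,\omega_n$ be real numbers without nontrivial integer relations $\sum_i m_i\omega_i=0$, $m_i\in\mathbb Z$, and consider the system of $n$ oscillators $\dot x=Ax+Bu$, $|u|\le 1$, in $\mathbb R^{2n}$ with coordinates $x=(x_1,y_1,\dots,x_n,y_n)$, where $A$ is block diagonal with blocks $\begin{pmatrix}0&1\\-\omega_i^2&0\end{pmatrix}$ and $B=(0,1,\dots,0,1)^*$. For $p=(\xi_1,\eta_1,\dots,\xi_n,\eta_n)\in\mathbb R^{2n}$ put $z_i=(\eta_i^2+\omega_i^{-2}\xi_i^2)^{1/2}$ and $$H_\Omega(p)=\frac1{(2\pi)^n}\int_0^{2\pi}\!\!\dots\int_0^{2\pi}\Bigl|\sum_{i=1}^n z_i\cos\varphi_i\Bigr|\,d\varphi_1\dots d\varphi_n .$$ Let $\Omega=\{x:(p,x)\le H_\Omega(p)\text{ for all }p\}$ be the convex body with support function $H_\Omega$, and let $\rho$ be its gauge (Minkowski functional) $\rho(x)=\inf\{r>0: x\in r\Omega\}$. A momentum at $x\ne0$ is a vector $p=p(x)\neq0$ with $\rho(x)^{-1}x=\frac{\partial H_\Omega}{\partial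 p}(p)$, and the feedback control is $u(x)=-\operatorname{sign}(B,p(x))$, where any value in $[-1,1]$ is allowed when $(B,p(x))=0$. A motion under this control on an interval is an absolutely continuous curve $x(t)$ such that for almost every $t$ one has $\dot x(t)=Ax(t)+Bu$ with $u$ a value of the feedback control at $x(t)$. Then there are constants $C>0$ and $c>0$, depending only on the system (that is, on $n$ and $\omega_1,\dots,\omega_n$), such that the following holds. If $x$ is a motion under the control on a time interval $[a,a+T]$ of integer length $T\ge 0$ with $\rho(x(t))\ge C$ for all $t\in[a,a+T]$, $\rho(x(a))=M$ and $\rho(x(a+T))=N$, then $T\le c\,(M-N)$. -/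

import Mathlib

open MeasureTheory

noncomputable section

namespace Oscillators

/-- The phase space `ℝ²ⁿ` (Euclidean). Coordinate `(0, i)` is the position `xᵢ` of the `i`-th
oscillator and `(1, i)` its velocity `yᵢ`; for a momentum `p` these are the dual variables
`ξᵢ` and `ηᵢ`. -/
abbrev Phase (n : ℕ) : Type := EuclideanSpace ℝ (Fin 2 × Fin n)

variable {n : ℕ}

/-- The block diagonal matrix `A` with blocks `(0, 1; -ωᵢ², 0)`. -/
def matA (ω : Fin n → ℝ) : Matrix (Fin 2 × Fin n) (Fin 2 × Fin n) ℝ :=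
  Matrix.blockDiagonal fun i => !![0, 1; -(ω i) ^ 2, 0]

/-- The vector `B = (0, 1, …, 0, 1)`. -/
def vecB (n : ℕ) : Phase n :=
  WithLp.toLp 2 fun k => if k.1 = 1 then 1 else 0

/-- There are no nontrivial integer relations between the frequencies. -/
def NonResonant (ω : Fin n → ℝ) : Prop :=
  ∀ m : Fin n → ℤ, ∑ i, (m i : ℝ) * ω i = 0 → m = 0

/-- `zᵢ = (ηᵢ² + ωᵢ⁻² ξᵢ²)^{1/2}`. -/
def amplitude (ω : Fin n → ℝ) (p : Phase n) (i : Fin n) : ℝ :=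
  Real.sqrt (p (1, i) ^ 2 + (ω i ^ 2)⁻¹ * p (0, i) ^ 2)

/-- `H_Ω(p) = (2π)⁻ⁿ ∫_{[0,2π]ⁿ} |∑ᵢ zᵢ cos φᵢ| dφ`. -/
def supportFn (ω : Fin n → ℝ) (p : Phase n) : ℝ :=
  ((2 * Real.pi) ^ n)⁻¹ *
    ∫ φ in Set.Icc (0 : Fin n → ℝ) (fun _ => 2 * Real.pi),
      |∑ i, amplitude ω p i * Real.cos (φ i)|

/-- The convex body `Ω` whose support function is `H_Ω`. -/
def body (ω : Fin n → ℝ) : Set (Phase n) :=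
  {x | ∀ p : Phase n, inner ℝ p x ≤ supportFn ω p}

/-- The radial coordinate `ρ(x)`: for `x ≠ 0` one has `x = ρ(x) φ` with `φ ∈ ∂Ω`. -/
def rho (ω : Fin n → ℝ) (x : Phase n) : ℝ :=
  gauge (body ω) x

/-- `p` is a momentum at `x`: `p ≠ 0` and `ρ(x)⁻¹ x = ∂H_Ω/∂p (p)`. -/
def IsMomentum (ω : Fin n → ℝ) (x p : Phase n) : Prop :=
  p ≠ 0 ∧ HasGradientAt (supportFn ω) ((rho ω x)⁻¹ • x) p

/-- The values at `x` of the feedback control `u(x) = -sign (B, p(x))`. On the switching surface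
`(B, p(x)) = 0` every value in `[-1, 1]` is admitted (the sign is understood as in
discontinuous differential equations, so that sliding motions are included). -/
def feedback (ω : Fin n → ℝ) (x : Phase n) : Set ℝ :=
  {u | ∃ p, IsMomentum ω x p ∧ |u| ≤ 1 ∧
    (inner ℝ (vecB n) p ≠ 0 → u = -Real.sign (inner ℝ (vecB n) p))}

/-- `x` is a motion on `[a, b]` under the feedback control: it is absolutely continuous and
`ẋ = A x + B u` with `u ∈ feedback (x)` at almost every time. -/
def IsMotion (ω : Fin n → ℝ) (a b : ℝ) (x : ℝ → Phase n) : Prop :=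
  AbsolutelyContinuousOnInterval x a b ∧
    ∀ᵐ t : ℝ, t ∈ Set.Ioo a b → ∃ u ∈ feedback ω (x t),
      HasDerivAt x (Matrix.toEuclideanLin (matA ω) (x t) + u • vecB n) t

end Oscillators

end

/-!
The uncontrolled motion preserves `ρ`, and under the control `ρ` decreases at the rate `|(B, p)|`,
where `p` is the momentum at `x(t)` normalized by `H_Ω(p) = 1`. It therefore suffices to bound
`∫ |(B, p(t))| dt` from below over a unit of time. Move the initial momentum by the adjoint flow
`ṗ = -A* p`, which preserves `H_Ω`: in a unit of time both `ρ(x)` and `(p, x)` change by `O(1)`, so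
for large `ρ` the transported vector is nearly extremal at `x(t)`. Since `H_Ω` is strictly convex,
it is then close to the true momentum. Along the adjoint flow the integral of `|(B, p)|` is
positive by controllability, and bounded away from zero by compactness of `{H_Ω = 1}`.

Strict convexity of `H_Ω`: equality in the triangle inequality for the mean of
`|∑ Re (wᵢ e^{iθᵢ})|` over the torus makes the trigonometric sums of `w` and `v` agree in sign
everywhere, and this forces `w` and `v` onto a common ray.
-/

namespace Oscillators

section StrictlyConvex

variable {V W : Type*} [AddCommGroup V] [Module ℝ V] [AddCommGroup W] [Module ℝ W]

/-- Strict convexity of a seminorm: equality in the triangle inequality holds only along a ray.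
Such a seminorm is a norm, as the choice `q = -p` shows. -/
def IsStrictlyConvex (h : Seminorm ℝ V) : Prop :=
  ∀ ⦃p q : V⦄, h (p + q) = h p + h q → SameRay ℝ p q

theorem IsStrictlyConvex.comp {h : Seminorm ℝ W} (hh : IsStrictlyConvex h) {f : V →ₗ[ℝ] W}
    (hf : Function.Injective f) : IsStrictlyConvex (h.comp f) := by
  intro p q hpq
  rw [Seminorm.comp_apply, map_add] at hpq
  exact (Function.Injective.sameRay_map_iff hf).1 (hh hpq)

variable {h : Seminorm ℝ V}

theorem IsStrictlyConvex.pos (hh : IsStrictlyConvex h) {p : V} (hp : p ≠ 0) : 0 < h p := by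
  refine (apply_nonneg h p).lt_of_ne' fun h0 => hp (eq_zero_of_sameRay_self_neg (hh ?_))
  rw [add_neg_cancel, map_zero, map_neg_eq_map, h0, add_zero]

theorem IsStrictlyConvex.eq_of_two_le_add (hh : IsStrictlyConvex h) {p q : V} (hp : h p = 1)
    (hq : h q = 1) (hpq : 2 ≤ h (p + q)) : p = q := by
  have hadd : h (p + q) = h p + h q :=
    le_antisymm (map_add_le_add h p q) (by rw [hp, hq]; linarith)
  have hp0 : p ≠ 0 := by
    rintro rfl
    simp at hp
  obtain ⟨r, hr, rfl⟩ := (hh hadd).exists_nonneg_left hp0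
  rw [map_smul_eq_mul, hp, mul_one, Real.norm_of_nonneg hr] at hq
  rw [hq, one_smul]

end StrictlyConvex

section NormedSpace

variable {V : Type*} [NormedAddCommGroup V] [NormedSpace ℝ V] {h : Seminorm ℝ V}

theorem apply_self_of_hasFDerivAt_seminorm {p : V} {h' : V →L[ℝ] ℝ} (hd : HasFDerivAt h h' p) :
    h' p = h p := by
  have hhom : (fun s : ℝ => (1 + s) * h p) =ᶠ[nhds 0] fun s => h (p + s • p) := by
    filter_upwards [lt_mem_nhds (by norm_num : (-1 : ℝ) < 0)] with s hs
    rw [show p + s • p = (1 + s) • p by rw [add_smul, one_smul], map_smul_eq_mul,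
      Real.norm_of_nonneg (by linarith)]
  have hlin : HasDerivAt (fun s : ℝ => (1 + s) * h p) (h p) 0 := by
    simpa using ((hasDerivAt_id (0 : ℝ)).const_add 1).mul_const (h p)
  exact (hlin.congr_of_eventuallyEq hhom.symm).unique (hd.hasLineDerivAt p) |>.symm

variable [FiniteDimensional ℝ V]

theorem continuous_seminorm_of_finiteDimensional (h : Seminorm ℝ V) : Continuous h :=
  continuousOn_univ.1 (h.convexOn.continuousOn isOpen_univ)

theorem IsStrictlyConvex.exists_mul_norm_le (hh : IsStrictlyConvex h) :
    ∃ k > 0, ∀ p, k * ‖p‖ ≤ h p := by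
  have := FiniteDimensional.proper_real V
  obtain ⟨k, hk, hsphere⟩ := (isCompact_sphere (0 : V) 1).exists_forall_le'
    (continuous_seminorm_of_finiteDimensional h).continuousOn (a := 0)
    (fun p hp => hh.pos (ne_zero_of_mem_unit_sphere ⟨p, hp⟩))
  refine ⟨k, hk, fun p => ?_⟩
  rcases eq_or_ne p 0 with rfl | hp
  · simp
  · have hunit := hsphere (‖p‖⁻¹ • p) (by simp [norm_smul, hp])
    rwa [map_smul_eq_mul, norm_inv, norm_norm, inv_mul_eq_div, le_div_iff₀ (norm_pos_iff.2 hp)]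
      at hunit

theorem IsStrictlyConvex.isCompact_unitSphere (hh : IsStrictlyConvex h) :
    IsCompact {p | h p = 1} := by
  have := FiniteDimensional.proper_real V
  obtain ⟨k, hk, hle⟩ := hh.exists_mul_norm_le
  refine Metric.isCompact_of_isClosed_isBounded
    (isClosed_eq (continuous_seminorm_of_finiteDimensional h) continuous_const)
    ((Metric.isBounded_closedBall (x := (0 : V)) (r := 1 / k)).subset fun p hp => ?_)
  rw [mem_closedBall_zero_iff, le_div_iff₀ hk, mul_comm]
  exact (hle p).trans_eq hp

end NormedSpace

section DualBody

variable {E : Type*} [NormedAddCommGroup E] [InnerProductSpace ℝ E]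

/-- The convex body with support function `h`. -/
def dualBody (h : Seminorm ℝ E) : Set E :=
  {x | ∀ p, inner ℝ p x ≤ h p}

theorem convex_dualBody (h : Seminorm ℝ E) : Convex ℝ (dualBody h) := by
  intro x hx y hy s t hs ht hst p
  calc inner ℝ p (s • x + t • y) = s * inner ℝ p x + t * inner ℝ p y := by
        rw [inner_add_right, inner_smul_right, inner_smul_right]
    _ ≤ s * h p + t * h p := by gcongr; exacts [hx p, hy p]
    _ = h p := by rw [← add_mul, hst, one_mul]

variable [FiniteDimensional ℝ E]

theorem isCompact_dualBody (h : Seminorm ℝ E) : IsCompact (dualBody h) := by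
  have := FiniteDimensional.proper_real E
  obtain ⟨K, hK, hle⟩ := Seminorm.bound_of_continuous_normedSpace h
    (continuous_seminorm_of_finiteDimensional h)
  refine Metric.isCompact_of_isClosed_isBounded ?_
    ((Metric.isBounded_closedBall (x := (0 : E)) (r := K)).subset fun x hx => ?_)
  · simp only [dualBody, Set.ofPred_forall]
    exact isClosed_iInter fun p => isClosed_le (by fun_prop) continuous_const
  · rw [mem_closedBall_zero_iff]
    rcases eq_or_ne x 0 with rfl | hx0
    · simpa using hK.le
    · have hself := (hx x).trans (hle x)
      rw [real_inner_self_eq_norm_mul_norm] at hself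
      exact le_of_mul_le_mul_right hself (norm_pos_iff.2 hx0)

variable {h : Seminorm ℝ E}

theorem IsStrictlyConvex.dualBody_mem_nhds (hh : IsStrictlyConvex h) : dualBody h ∈ nhds 0 := by
  obtain ⟨k, hk, hle⟩ := hh.exists_mul_norm_le
  refine Filter.mem_of_superset (Metric.closedBall_mem_nhds 0 hk) fun x hx p => ?_
  rw [mem_closedBall_zero_iff] at hx
  calc inner ℝ p x ≤ ‖p‖ * ‖x‖ := real_inner_le_norm _ _
    _ ≤ ‖p‖ * k := by gcongr
    _ ≤ h p := by rw [mul_comm]; exact hle p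

theorem IsStrictlyConvex.inner_le_mul_gauge (hh : IsStrictlyConvex h) (p x : E) :
    inner ℝ p x ≤ h p * gauge (dualBody h) x := by
  have hlim : Filter.Tendsto (fun r => h p * r) (nhdsWithin (gauge (dualBody h) x)
      (Set.Ioi (gauge (dualBody h) x))) (nhds (h p * gauge (dualBody h) x)) :=
    (Continuous.tendsto (by fun_prop) _).mono_left nhdsWithin_le_nhds
  refine ge_of_tendsto hlim ?_
  filter_upwards [self_mem_nhdsWithin] with r hr
  obtain ⟨b, hb, hbr, y, hy, rfl⟩ :=
    exists_lt_of_gauge_lt (absorbent_nhds_zero hh.dualBody_mem_nhds) hr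
  calc inner ℝ p (b • y) = b * inner ℝ p y := inner_smul_right _ _ _
    _ ≤ b * h p := by gcongr; exact hy p
    _ ≤ h p * r := by
      rw [mul_comm]; exact mul_le_mul_of_nonneg_left hbr.le (apply_nonneg h p)

theorem IsStrictlyConvex.inv_gauge_smul_mem_dualBody (hh : IsStrictlyConvex h) {x : E}
    (hx : 0 < gauge (dualBody h) x) : (gauge (dualBody h) x)⁻¹ • x ∈ dualBody h := by
  intro p
  rw [inner_smul_right, inv_mul_eq_div, div_le_iff₀ hx]
  exact hh.inner_le_mul_gauge p x

/-- `p` is the outer normal, normalized by `h p = 1`, of the level set of the gauge of `dualBody h`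
through `x`: it attains the maximum of `inner ℝ p x / h p`. -/
def IsNormal (h : Seminorm ℝ E) (x p : E) : Prop :=
  h p = 1 ∧ inner ℝ p x = gauge (dualBody h) x

theorem IsStrictlyConvex.inner_le_gauge (hh : IsStrictlyConvex h) {p : E} (hp : h p = 1) (x : E) :
    inner ℝ p x ≤ gauge (dualBody h) x := by
  simpa [hp] using hh.inner_le_mul_gauge p x

theorem IsStrictlyConvex.exists_isNormal (hh : IsStrictlyConvex h) {x : E} (hx : x ≠ 0) :
    ∃ p, IsNormal h x p := by
  have hnonempty : {p | h p = 1}.Nonempty :=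
    ⟨(h x)⁻¹ • x, by
      rw [Set.mem_ofPred_eq, map_smul_eq_mul, norm_inv, Real.norm_of_nonneg (apply_nonneg h x),
        inv_mul_cancel₀ (hh.pos hx).ne']⟩
  obtain ⟨p, hp, hmax⟩ := hh.isCompact_unitSphere.exists_isMaxOn hnonempty
    (f := fun p => inner ℝ p x) (by fun_prop)
  have hle : ∀ q, inner ℝ q x ≤ h q * inner ℝ p x := by
    intro q
    rcases eq_or_ne q 0 with rfl | hq
    · simp
    have hq := hh.pos hq
    have hunit : inner ℝ ((h q)⁻¹ • q) x ≤ inner ℝ p x := hmax (by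
      rw [Set.mem_ofPred_eq, map_smul_eq_mul, norm_inv, Real.norm_of_nonneg hq.le,
        inv_mul_cancel₀ hq.ne'])
    rwa [real_inner_smul_left, inv_mul_le_iff₀ hq] at hunit
  have hpos : 0 < inner ℝ p x :=
    pos_of_mul_pos_right ((real_inner_self_pos.2 hx).trans_le (hle x)) (apply_nonneg h x)
  refine ⟨p, hp, (hh.inner_le_gauge hp x).antisymm ?_⟩
  refine gauge_le_of_mem hpos.le ⟨(inner ℝ p x)⁻¹ • x, fun q => ?_, ?_⟩
  · rw [inner_smul_right, inv_mul_le_iff₀ hpos, mul_comm]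
    exact hle q
  · exact smul_inv_smul₀ hpos.ne' x

theorem IsStrictlyConvex.exists_norm_sub_lt_of_isNormal (hh : IsStrictlyConvex h) {ε : ℝ}
    (hε : 0 < ε) :
    ∃ δ > 0, ∀ x p q, IsNormal h x p → h q = 1 →
      (1 - δ) * gauge (dualBody h) x < inner ℝ q x → ‖p - q‖ < ε := by
  have hcompact : IsCompact ((dualBody h ×ˢ {p | h p = 1} ×ˢ {p | h p = 1}) ∩
      ({w | inner ℝ w.2.1 w.1 = (1 : ℝ)} ∩ {w | ε ≤ ‖w.2.1 - w.2.2‖})) :=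
    ((isCompact_dualBody h).prod (hh.isCompact_unitSphere.prod
      hh.isCompact_unitSphere)).inter_right ((isClosed_eq (by fun_prop) continuous_const).inter
        (isClosed_le continuous_const (by fun_prop)))
  obtain ⟨δ, hδ, hgap⟩ := hcompact.exists_forall_le' (f := fun w => (1 : ℝ) - inner ℝ w.2.2 w.1)
    (by fun_prop) (a := 0) (by
      rintro ⟨y, p, q⟩ ⟨⟨hy, hp, hq⟩, hpy, hpq⟩
      by_contra! hqy
      -- Now `p` and `q` both support the body at `y`, whence `h (p + q) = 2`.
      have hsum := hy (p + q)
      rw [inner_add_left] at hsum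
      obtain rfl : p = q := hh.eq_of_two_le_add hp hq (by linarith [hpy.ge])
      simp only [Set.mem_ofPred_eq, sub_self, norm_zero] at hpq
      linarith)
  refine ⟨δ, hδ, fun x p q hp hq hqx => ?_⟩
  by_contra! hpq
  have hx : 0 < gauge (dualBody h) x := by
    have := hh.inner_le_gauge hq x
    exact pos_of_mul_pos_right (by linarith : 0 < δ * gauge (dualBody h) x) hδ.le
  have hle := hgap ((gauge (dualBody h) x)⁻¹ • x, p, q)
    ⟨⟨hh.inv_gauge_smul_mem_dualBody hx, hp.1, hq⟩,
      by simp [inner_smul_right, hp.2, hx.ne'], hpq⟩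
  rw [inner_smul_right, inv_mul_eq_div, le_sub_comm, div_le_iff₀ hx] at hle
  linarith

end DualBody

section AbsoluteContinuity

theorem absolutelyContinuousOnInterval_lipschitz_comp {X Y : Type*} [PseudoMetricSpace X]
    [PseudoMetricSpace Y] {g : X → Y} {K : NNReal} (hg : LipschitzWith K g) {f : ℝ → X} {a b : ℝ}
    (hf : AbsolutelyContinuousOnInterval f a b) :
    AbsolutelyContinuousOnInterval (fun t => g (f t)) a b := by
  refine squeeze_zero (fun E => Finset.sum_nonneg fun _ _ => dist_nonneg) (fun E => ?_)
    (by simpa using Filter.Tendsto.const_mul (K : ℝ) hf)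
  rw [Finset.mul_sum]
  exact Finset.sum_le_sum fun i _ => hg.dist_le_mul _ _

theorem absolutelyContinuousOnInterval_inner {E : Type*} [NormedAddCommGroup E]
    [InnerProductSpace ℝ E] {f g : ℝ → E} {a b : ℝ} (hf : AbsolutelyContinuousOnInterval f a b)
    (hg : AbsolutelyContinuousOnInterval g a b) :
    AbsolutelyContinuousOnInterval (fun t => inner ℝ (f t) (g t)) a b := by
  have hadd := absolutelyContinuousOnInterval_lipschitz_comp lipschitzWith_one_norm (hf.fun_add hg)
  have hsub := absolutelyContinuousOnInterval_lipschitz_comp lipschitzWith_one_norm (hf.fun_sub hg)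
  convert ((hadd.fun_mul hadd).fun_sub (hsub.fun_mul hsub)).const_mul (1 / 4) using 2 with t
  rw [norm_add_mul_self_real, norm_sub_mul_self_real]
  ring

theorem sub_le_integral_of_ae_deriv_le {f g : ℝ → ℝ} {a b : ℝ} (hab : a ≤ b)
    (hf : AbsolutelyContinuousOnInterval f a b) (hg : Continuous g)
    (hfg : ∀ᵐ t, t ∈ Set.Ioo a b → deriv f t ≤ g t) : f b - f a ≤ ∫ t in a..b, g t := by
  rw [← hf.integral_deriv_eq_sub]
  refine intervalIntegral.integral_mono_ae_restrict hab hf.intervalIntegrable_deriv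
    (hg.intervalIntegrable a b) ?_
  rw [← restrict_Ioo_eq_restrict_Icc]
  exact (ae_restrict_iff' measurableSet_Ioo).2 hfg

end AbsoluteContinuity

section AdjointFlow

variable {E : Type*} [NormedAddCommGroup E] [InnerProductSpace ℝ E] [FiniteDimensional ℝ E]

/-- The flow of the adjoint equation `ṗ = -A* p`, which is the law of the momenta of the control
system `ẋ = A x + b u`. -/
noncomputable def adjointFlow (A : E →ₗ[ℝ] E) (t : ℝ) : E →L[ℝ] E :=
  NormedSpace.exp (t • -LinearMap.toContinuousLinearMap (LinearMap.adjoint A))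

variable {A : E →ₗ[ℝ] E}

theorem adjointFlow_zero (p : E) : adjointFlow A 0 p = p := by
  rw [adjointFlow, zero_smul, NormedSpace.exp_zero, one_apply_eq_self]

theorem hasDerivAt_adjointFlow (p : E) (t : ℝ) :
    HasDerivAt (fun s => adjointFlow A s p) (-LinearMap.adjoint A (adjointFlow A t p)) t := by
  have := FiniteDimensional.complete ℝ E
  exact (hasDerivAt_exp_smul_const' (-LinearMap.toContinuousLinearMap (LinearMap.adjoint A)) t
    ).clm_apply (hasDerivAt_const t p) |>.congr_deriv (by simp [adjointFlow])

theorem continuous_adjointFlow : Continuous fun q : E × ℝ => adjointFlow A q.2 q.1 := by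
  have := FiniteDimensional.complete ℝ E
  have hexp : Continuous (adjointFlow A) := continuous_iff_continuousAt.2 fun t =>
    (hasDerivAt_exp_smul_const' (-LinearMap.toContinuousLinearMap (LinearMap.adjoint A))
      t).continuousAt
  exact (hexp.comp continuous_snd).clm_apply continuous_fst

theorem contDiff_adjointFlow (p : E) : ContDiff ℝ 1 fun t => adjointFlow A t p := by
  refine contDiff_one_iff_deriv.2 ⟨fun t => (hasDerivAt_adjointFlow p t).differentiableAt, ?_⟩
  rw [funext fun t => (hasDerivAt_adjointFlow (A := A) p t).deriv]
  exact ((LinearMap.adjoint A).continuous_of_finiteDimensional.comp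
    (continuous_adjointFlow.comp (by fun_prop : Continuous fun t => (p, t)))).neg

theorem hasDerivAt_inner_adjointFlow {x : ℝ → E} {x' : E} {t : ℝ} (hx : HasDerivAt x x' t)
    (a : ℝ) (p : E) : HasDerivAt (fun s => inner ℝ (adjointFlow A (s - a) p) (x s))
      (inner ℝ (adjointFlow A (t - a) p) (x' - A (x t))) t := by
  refine (((hasDerivAt_adjointFlow p (t - a)).comp_sub_const t a).inner ℝ hx).congr_deriv ?_
  rw [inner_neg_left, LinearMap.adjoint_inner_left, inner_sub_right, ← sub_eq_add_neg]

/-- Kalman's rank condition for the pair `(A, b)`: no nonzero vector is orthogonal to all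
`A ^ k b`. -/
def IsControllable (A : E →ₗ[ℝ] E) (b : E) : Prop :=
  ∀ p, (∀ k : ℕ, inner ℝ p ((A ^ k) b) = 0) → p = 0

variable {b : E}

theorem inner_adjointFlow_pow_eq_zero {p : E} {U : Set ℝ} (hU : IsOpen U)
    (hzero : ∀ t ∈ U, inner ℝ (adjointFlow A t p) b = 0) (k : ℕ) :
    ∀ t ∈ U, inner ℝ (adjointFlow A t p) ((A ^ k) b) = 0 := by
  induction k with
  | zero => simpa using hzero
  | succ k ih =>
    intro t ht
    have hderiv := hasDerivAt_inner_adjointFlow (A := A) (hasDerivAt_const t ((A ^ k) b)) 0 p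
    have hlocal := (hasDerivAt_const t (0 : ℝ)).congr_of_eventuallyEq
      (Filter.eventually_of_mem (hU.mem_nhds ht) ih)
    simp only [sub_zero, zero_sub, inner_neg_right] at hderiv
    simpa [pow_succ'] using hderiv.unique hlocal

variable {h : Seminorm ℝ E}

theorem IsControllable.exists_le_integral (hb : IsControllable A b) (hh : IsStrictlyConvex h)
    (hinv : ∀ t p, h (adjointFlow A t p) = h p) {τ : ℝ} (hτ : 0 < τ) :
    ∃ κ > 0, ∀ p, h p = 1 → κ ≤ ∫ t in 0..τ, |inner ℝ (adjointFlow A t p) b| := by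
  have hcont : Continuous fun q : E × ℝ => |inner ℝ (adjointFlow A q.2 q.1) b| :=
    (continuous_adjointFlow.inner continuous_const).abs
  refine hh.isCompact_unitSphere.exists_forall_le'
    (intervalIntegral.continuous_parametric_intervalIntegral_of_continuous' hcont 0 τ).continuousOn
    fun p hp => ?_
  obtain ⟨t, ht, hne⟩ : ∃ t ∈ Set.Ioo 0 τ, inner ℝ (adjointFlow A t p) b ≠ 0 := by
    by_contra! hzero
    obtain ⟨t, ht⟩ := Set.nonempty_Ioo.2 hτ
    have hflow := hb _ fun k => inner_adjointFlow_pow_eq_zero isOpen_Ioo hzero k t ht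
    have hp' := hinv t p
    rw [hflow, map_zero, hp] at hp'
    exact zero_ne_one hp'
  exact intervalIntegral.integral_pos hτ
    (hcont.comp (by fun_prop : Continuous fun t => (p, t))).continuousOn (fun _ _ => abs_nonneg _)
    ⟨t, Set.Ioo_subset_Icc_self ht, abs_pos.2 hne⟩

theorem IsNormal.inner_map_eq_zero (hh : IsStrictlyConvex h)
    (hinv : ∀ t p, h (adjointFlow A t p) = h p) {x p : E} (hp : IsNormal h x p) :
    inner ℝ p (A x) = 0 := by
  have hmax : IsLocalMax (fun t => inner ℝ (adjointFlow A (t - 0) p) x) 0 :=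
    Filter.Eventually.of_forall fun t => by
      simpa [adjointFlow_zero, hp.2] using hh.inner_le_gauge ((hinv t p).trans hp.1) x
  simpa [adjointFlow_zero] using
    hmax.hasDerivAt_eq_zero (hasDerivAt_inner_adjointFlow (hasDerivAt_const 0 x) 0 p)

end AdjointFlow

section FrictionMotion

variable {E : Type*} [NormedAddCommGroup E] [InnerProductSpace ℝ E]

/-- `x` is a motion on `[a, c]` of the system `ẋ = A x + u b` under the dry-friction control
`u = -sign (p, b)`, where `p` is the normal at `x` to the level set of the gauge of `dualBody h`.
The equation `u (p, b) = -|(p, b)|` leaves `u ∈ [-1, 1]` free where `(p, b) = 0`. -/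
def IsFrictionMotion (h : Seminorm ℝ E) (A : E →ₗ[ℝ] E) (b : E) (a c : ℝ) (x : ℝ → E) : Prop :=
  AbsolutelyContinuousOnInterval x a c ∧ ∀ᵐ t, t ∈ Set.Ioo a c → ∃ u p, |u| ≤ 1 ∧
    IsNormal h (x t) p ∧ u * inner ℝ p b = -|inner ℝ p b| ∧ HasDerivAt x (A (x t) + u • b) t

variable {h : Seminorm ℝ E} {A : E →ₗ[ℝ] E} {b : E} {a c : ℝ} {x : ℝ → E}

theorem IsFrictionMotion.mono (hx : IsFrictionMotion h A b a c x) {a' c' : ℝ} (ha : a ≤ a')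
    (hac : a' ≤ c') (hc : c' ≤ c) : IsFrictionMotion h A b a' c' x := by
  refine ⟨hx.1.mono ?_, ?_⟩
  · rw [Set.uIcc_of_le hac, Set.uIcc_of_le (ha.trans (hac.trans hc))]
    exact Set.Icc_subset_Icc ha hc
  · filter_upwards [hx.2] with t ht htac
    exact ht (Set.Ioo_subset_Ioo ha hc htac)

variable [FiniteDimensional ℝ E]

theorem IsFrictionMotion.absolutelyContinuousOnInterval_gauge (hh : IsStrictlyConvex h)
    (hx : IsFrictionMotion h A b a c x) :
    AbsolutelyContinuousOnInterval (fun t => gauge (dualBody h) (x t)) a c :=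
  have ⟨_, hK⟩ := (convex_dualBody h).lipschitz_gauge hh.dualBody_mem_nhds
  absolutelyContinuousOnInterval_lipschitz_comp hK hx.1

theorem IsNormal.deriv_gauge_comp (hh : IsStrictlyConvex h) {x' p : E} {t : ℝ}
    (hp : IsNormal h (x t) p) (hx : HasDerivAt x x' t)
    (hd : DifferentiableAt ℝ (fun s => gauge (dualBody h) (x s)) t) :
    deriv (fun s => gauge (dualBody h) (x s)) t = inner ℝ p x' := by
  have hmin : IsLocalMin (fun s => gauge (dualBody h) (x s) - inner ℝ p (x s)) t :=
    Filter.Eventually.of_forall fun s => by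
      simpa [hp.2] using hh.inner_le_gauge hp.1 (x s)
  have hinner : HasDerivAt (fun s => inner ℝ p (x s)) (inner ℝ p x') t := by
    simpa using (hasDerivAt_const t p).inner ℝ hx
  exact sub_eq_zero.1 (hmin.hasDerivAt_eq_zero (hd.hasDerivAt.sub hinner))

theorem IsFrictionMotion.ae_deriv_gauge (hh : IsStrictlyConvex h)
    (hinv : ∀ t p, h (adjointFlow A t p) = h p) (hx : IsFrictionMotion h A b a c x) :
    ∀ᵐ t, t ∈ Set.Ioo a c → ∃ p, IsNormal h (x t) p ∧
      deriv (fun s => gauge (dualBody h) (x s)) t = -|inner ℝ p b| := by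
  filter_upwards [hx.2, (hx.absolutelyContinuousOnInterval_gauge hh).ae_differentiableAt]
    with t ht hd htac
  obtain ⟨u, p, -, hp, hup, hxt⟩ := ht htac
  refine ⟨p, hp, ?_⟩
  rw [hp.deriv_gauge_comp hh hxt (hd (Set.Icc_subset_uIcc (Set.Ioo_subset_Icc_self htac))),
    inner_add_right, hp.inner_map_eq_zero hh hinv, zero_add, inner_smul_right, hup]

theorem IsFrictionMotion.gauge_le (hh : IsStrictlyConvex h)
    (hinv : ∀ t p, h (adjointFlow A t p) = h p) (hac : a ≤ c) (hx : IsFrictionMotion h A b a c x) :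
    gauge (dualBody h) (x c) ≤ gauge (dualBody h) (x a) := by
  have hle := sub_le_integral_of_ae_deriv_le hac (hx.absolutelyContinuousOnInterval_gauge hh)
    (g := fun _ => 0) continuous_const (by
      filter_upwards [hx.ae_deriv_gauge hh hinv] with t ht htac
      obtain ⟨p, -, hp⟩ := ht htac
      exact hp.trans_le (neg_nonpos.2 (abs_nonneg _)))
  simpa using hle

theorem IsFrictionMotion.gauge_sub_le_inner (hh : IsStrictlyConvex h)
    (hinv : ∀ t p, h (adjointFlow A t p) = h p) {K : ℝ} (hK : ∀ p, h p = 1 → |inner ℝ p b| ≤ K)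
    (hac : a ≤ c) (hx : IsFrictionMotion h A b a c x) {p : E} (hp : IsNormal h (x a) p) :
    gauge (dualBody h) (x c) - K * (c - a) ≤ inner ℝ (adjointFlow A (c - a) p) (x c) := by
  have hflow : AbsolutelyContinuousOnInterval (fun t => adjointFlow A (t - a) p) a c :=
    ((contDiff_adjointFlow p).comp (contDiff_id.sub contDiff_const)).contDiffOn
      |>.absolutelyContinuousOnInterval
  have hle := sub_le_integral_of_ae_deriv_le hac
    (absolutelyContinuousOnInterval_inner hflow hx.1).fun_neg (g := fun _ => K)
    continuous_const (by
      filter_upwards [hx.2] with t ht htac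
      obtain ⟨u, -, hu, -, -, hxt⟩ := ht htac
      rw [(hasDerivAt_inner_adjointFlow hxt a p).fun_neg.deriv, add_sub_cancel_left,
        inner_smul_right]
      calc -(u * inner ℝ (adjointFlow A (t - a) p) b)
          ≤ |u| * |inner ℝ (adjointFlow A (t - a) p) b| := by
            rw [← abs_mul]; exact neg_le_abs _
        _ ≤ |inner ℝ (adjointFlow A (t - a) p) b| := mul_le_of_le_one_left (abs_nonneg _) hu
        _ ≤ K := hK _ ((hinv _ p).trans hp.1))
  have hmono := hx.gauge_le hh hinv hac
  simp only [sub_self, adjointFlow_zero, hp.2, intervalIntegral.integral_const, smul_eq_mul] at hle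
  linarith

theorem exists_norm_sub_adjointFlow_lt (b : E) (hh : IsStrictlyConvex h)
    (hinv : ∀ t p, h (adjointFlow A t p) = h p) {ε : ℝ} (hε : 0 < ε) :
    ∃ C > 0, ∀ (x : ℝ → E) (a c : ℝ) (p q : E), a ≤ c → c ≤ a + 1 →
      IsFrictionMotion h A b a c x → C ≤ gauge (dualBody h) (x c) →
      IsNormal h (x a) p → IsNormal h (x c) q → ‖q - adjointFlow A (c - a) p‖ < ε := by
  obtain ⟨K, hK⟩ : ∃ K, ∀ p, h p = 1 → |inner ℝ p b| ≤ K :=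
    hh.isCompact_unitSphere.exists_bound_of_continuousOn (f := fun p => inner ℝ p b)
      (by fun_prop)
  obtain ⟨δ, hδ, hstable⟩ := hh.exists_norm_sub_lt_of_isNormal hε
  refine ⟨(|K| + 1) / δ, by positivity, fun x a c p q hac hca hx hC hp hq => ?_⟩
  refine hstable _ _ _ hq ((hinv _ p).trans hp.1)
    (lt_of_lt_of_le ?_ (hx.gauge_sub_le_inner hh hinv hK hac hp))
  have hlarge : |K| + 1 ≤ gauge (dualBody h) (x c) * δ := (div_le_iff₀ hδ).1 hC
  have hshort : K * (c - a) ≤ |K| := by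
    calc K * (c - a) ≤ |K| * (c - a) := by gcongr; exact le_abs_self K
      _ ≤ |K| := mul_le_of_le_one_right (abs_nonneg K) (by linarith)
  linarith

theorem exists_abs_inner_adjointFlow_le (b : E) (hh : IsStrictlyConvex h)
    (hinv : ∀ t p, h (adjointFlow A t p) = h p) {ε : ℝ} (hε : 0 < ε) :
    ∃ C > 0, ∀ (x : ℝ → E) (a c : ℝ) (p q : E), a ≤ c → c ≤ a + 1 →
      IsFrictionMotion h A b a c x → C ≤ gauge (dualBody h) (x c) →
      IsNormal h (x a) p → IsNormal h (x c) q →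
      |inner ℝ (adjointFlow A (c - a) p) b| ≤ |inner ℝ q b| + ε := by
  obtain ⟨C, hC, hnear⟩ := exists_norm_sub_adjointFlow_lt b hh hinv
    (div_pos hε (by positivity : 0 < ‖b‖ + 1))
  refine ⟨C, hC, fun x a c p q hac hca hx hlarge hp hq => sub_le_iff_le_add'.1 ?_⟩
  have hclose := hnear x a c p q hac hca hx hlarge hp hq
  calc |inner ℝ (adjointFlow A (c - a) p) b| - |inner ℝ q b|
      ≤ |inner ℝ (q - adjointFlow A (c - a) p) b| := by
        rw [inner_sub_left, abs_sub_comm]; exact abs_sub_abs_le_abs_sub _ _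
    _ ≤ ‖q - adjointFlow A (c - a) p‖ * ‖b‖ := abs_real_inner_le_norm _ _
    _ ≤ ε / (‖b‖ + 1) * (‖b‖ + 1) := by gcongr; exact le_add_of_nonneg_right zero_le_one
    _ = ε := div_mul_cancel₀ _ (by positivity)

theorem IsControllable.exists_gauge_add_le (hb : IsControllable A b) (hh : IsStrictlyConvex h)
    (hinv : ∀ t p, h (adjointFlow A t p) = h p) :
    ∃ C > 0, ∃ κ > 0, ∀ (x : ℝ → E) (a : ℝ), IsFrictionMotion h A b a (a + 1) x →
      (∀ t ∈ Set.Icc a (a + 1), C ≤ gauge (dualBody h) (x t)) →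
      gauge (dualBody h) (x (a + 1)) + κ ≤ gauge (dualBody h) (x a) := by
  obtain ⟨κ, hκ, hobs⟩ := hb.exists_le_integral hh hinv one_pos
  obtain ⟨C, hC, hnear⟩ := exists_abs_inner_adjointFlow_le b hh hinv (half_pos hκ)
  refine ⟨C, hC, κ / 2, half_pos hκ, fun x a hx hlarge => ?_⟩
  have hxa : x a ≠ 0 := fun h0 => by
    have := hlarge a ⟨le_rfl, by linarith⟩
    rw [h0, gauge_zero] at this
    linarith
  obtain ⟨p, hp⟩ := hh.exists_isNormal hxa
  have hcont : Continuous fun t => |inner ℝ (adjointFlow A (t - a) p) b| :=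
    ((continuous_adjointFlow.comp (by fun_prop : Continuous fun t => (p, t - a))).inner
      continuous_const).abs
  have hdrop := sub_le_integral_of_ae_deriv_le (by linarith)
    (hx.absolutelyContinuousOnInterval_gauge hh)
    (g := fun t => κ / 2 - |inner ℝ (adjointFlow A (t - a) p) b|) (by fun_prop) (by
      filter_upwards [hx.ae_deriv_gauge hh hinv] with t ht hta
      obtain ⟨q, hq, hderiv⟩ := ht hta
      have hclose := hnear x a t p q hta.1.le hta.2.le (hx.mono le_rfl hta.1.le hta.2.le)
        (hlarge t (Set.Ioo_subset_Icc_self hta)) hp hq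
      rw [hderiv]
      linarith)
  rw [intervalIntegral.integral_sub (by simp) (hcont.intervalIntegrable _ _),
    intervalIntegral.integral_const,
    intervalIntegral.integral_comp_sub_right (fun t => |inner ℝ (adjointFlow A t p) b|) a,
    sub_self, add_sub_cancel_left, one_smul] at hdrop
  linarith [hobs p hp.1]

theorem IsControllable.exists_floor_mul_le (hb : IsControllable A b) (hh : IsStrictlyConvex h)
    (hinv : ∀ t p, h (adjointFlow A t p) = h p) :
    ∃ C > 0, ∃ κ > 0, ∀ (x : ℝ → E) (a T : ℝ), 0 ≤ T → IsFrictionMotion h A b a (a + T) x →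
      (∀ t ∈ Set.Icc a (a + T), C ≤ gauge (dualBody h) (x t)) →
      ⌊T⌋₊ * κ ≤ gauge (dualBody h) (x a) - gauge (dualBody h) (x (a + T)) := by
  obtain ⟨C, hC, κ, hκ, hdrop⟩ := hb.exists_gauge_add_le hh hinv
  refine ⟨C, hC, κ, hκ, fun x a T hT hx hlarge => ?_⟩
  have hsteps : ∀ k : ℕ, k ≤ T →
      k * κ ≤ gauge (dualBody h) (x a) - gauge (dualBody h) (x (a + k)) := by
    intro k
    induction k with
    | zero => simp
    | succ k ih =>
      intro hk
      push_cast at hk ⊢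
      have := k.cast_nonneg (α := ℝ)
      have hstep := hdrop x (a + k) (hx.mono (by linarith) (by linarith) (by linarith))
        fun t ht => hlarge t ⟨by linarith [ht.1], by linarith [ht.2]⟩
      rw [← add_assoc]
      linarith [ih (by linarith)]
  have hfloor := Nat.floor_le hT
  have hlast := (hx.mono (by linarith [⌊T⌋₊.cast_nonneg (α := ℝ)]) (by linarith) le_rfl).gauge_le
    (a := a + ⌊T⌋₊) hh hinv (by linarith)
  linarith [hsteps ⌊T⌋₊ hfloor]

end FrictionMotion

section TrigonometricSums

theorem sameRay_of_forall_mul_nonneg {V : Type*} [AddCommGroup V] [Module ℝ V] {f g : V →ₗ[ℝ] ℝ}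
    (hfg : ∀ x, 0 ≤ f x * g x) : SameRay ℝ f g := by
  rcases eq_or_ne f 0 with rfl | hf
  · exact SameRay.zero_left _
  obtain ⟨y, hy⟩ : ∃ y, f y = 1 := by
    obtain ⟨x, hx⟩ := DFunLike.ne_iff.1 hf
    exact ⟨(f x)⁻¹ • x, by simpa using inv_mul_cancel₀ hx⟩
  have hker : ∀ x, f x = 0 → g x = 0 := by
    intro x hx
    by_contra hgx
    have hneg := hfg (y + (-(1 + g y) / g x) • x)
    rw [map_add, map_add, map_smul, map_smul, hx, hy, smul_eq_mul, smul_eq_mul,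
      div_mul_cancel₀ _ hgx] at hneg
    linarith
  have hg : g = g y • f := by
    ext x
    have hx := hker (x - f x • y) (by simp [hy])
    rw [map_sub, map_smul, smul_eq_mul, sub_eq_zero] at hx
    rw [hx, LinearMap.smul_apply, smul_eq_mul, mul_comm]
  rw [hg]
  exact SameRay.sameRay_nonneg_smul_right f (by simpa [hy] using hfg y)

instance fact_two_pi_pos : Fact (0 < 2 * Real.pi) := ⟨Real.two_pi_pos⟩

theorem exists_mul_toCircle_eq_norm {ι : Type*} (w : ι → ℂ) : ∃ α : ι → AddCircle (2 * Real.pi),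
    (fun i => w i * AddCircle.toCircle (α i)) = fun i => (‖w i‖ : ℂ) := by
  refine ⟨fun i => ((-(w i).arg : ℝ) : AddCircle (2 * Real.pi)), funext fun i => ?_⟩
  rw [AddCircle.toCircle_apply_mk, div_self Real.two_pi_pos.ne', one_mul, Circle.coe_exp]
  nth_rw 1 [← Complex.norm_mul_exp_arg_mul_I (w i)]
  rw [mul_assoc, ← Complex.exp_add, Complex.ofReal_neg, neg_mul, add_neg_cancel, Complex.exp_zero,
    mul_one]

variable {ι : Type*} [Fintype ι]

/-- The trigonometric sum `∑ᵢ Re (wᵢ e^{iθᵢ})` on the torus. -/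
noncomputable def trigSum (w : ι → ℂ) (θ : ι → AddCircle (2 * Real.pi)) : ℝ :=
  ∑ i, (w i * AddCircle.toCircle (θ i)).re

theorem trigSum_coe (w : ι → ℂ) (φ : ι → ℝ) :
    trigSum w (fun i => (φ i : AddCircle (2 * Real.pi))) =
      ∑ i, ((w i).re * Real.cos (φ i) - (w i).im * Real.sin (φ i)) := by
  refine Finset.sum_congr rfl fun i _ => ?_
  rw [AddCircle.toCircle_apply_mk, div_self Real.two_pi_pos.ne', one_mul, Circle.coe_exp,
    Complex.mul_re, Complex.exp_ofReal_mul_I_re, Complex.exp_ofReal_mul_I_im]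

theorem trigSum_add (w v : ι → ℂ) (θ : ι → AddCircle (2 * Real.pi)) :
    trigSum (w + v) θ = trigSum w θ + trigSum v θ := by
  simp only [trigSum, Pi.add_apply, add_mul, Complex.add_re, Finset.sum_add_distrib]

theorem trigSum_smul (r : ℝ) (w : ι → ℂ) (θ : ι → AddCircle (2 * Real.pi)) :
    trigSum (r • w) θ = r * trigSum w θ := by
  simp only [trigSum, Pi.smul_apply, smul_mul_assoc, Complex.smul_re, smul_eq_mul, Finset.mul_sum]

theorem trigSum_mul_toCircle (w : ι → ℂ) (α θ : ι → AddCircle (2 * Real.pi)) :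
    trigSum (fun i => w i * AddCircle.toCircle (α i)) θ = trigSum w (α + θ) := by
  simp only [trigSum, Pi.add_apply, AddCircle.toCircle_add, Circle.coe_mul, mul_assoc]

@[fun_prop]
theorem continuous_trigSum (w : ι → ℂ) : Continuous (trigSum w) :=
  continuous_finsetSum _ fun i _ => Complex.continuous_re.comp <| continuous_const.mul <|
    continuous_subtype_val.comp <| AddCircle.continuous_toCircle.comp <| continuous_apply i

theorem integrable_torus {F : (ι → AddCircle (2 * Real.pi)) → ℝ} (hF : Continuous F) :
    Integrable F :=
  hF.integrable_of_hasCompactSupport (HasCompactSupport.of_compactSpace F)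

theorem integral_cube_eq_integral_torus {F : (ι → AddCircle (2 * Real.pi)) → ℝ}
    (hF : Continuous F) :
    ∫ φ in Set.Icc (0 : ι → ℝ) (fun _ => 2 * Real.pi), F (fun i => (φ i : AddCircle _)) =
      ∫ θ, F θ := by
  have hmk := measurePreserving_pi _ _
    (fun _ : ι => AddCircle.measurePreserving_mk (2 * Real.pi) 0)
  rw [volume_pi, volume_pi, ← hmk.map_eq,
    integral_map hmk.measurable.aemeasurable hF.aestronglyMeasurable, ← Measure.restrict_pi_pi,
    zero_add]
  exact (setIntegral_congr_set (Measure.univ_pi_Ioc_ae_eq_Icc (f := fun _ : ι => (0 : ℝ))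
    (g := fun _ => 2 * Real.pi))).symm

/-- The mean of `|∑ᵢ Re (wᵢ e^{iθᵢ})|` over the torus, as a seminorm in `w`. -/
noncomputable def trigSeminorm (ι : Type*) [Fintype ι] : Seminorm ℝ (ι → ℂ) :=
  Seminorm.of (fun w => ((2 * Real.pi) ^ Fintype.card ι)⁻¹ * ∫ θ, |trigSum w θ|)
    (fun w v => by
      rw [← mul_add, ← integral_add (integrable_torus (by fun_prop))
        (integrable_torus (by fun_prop))]
      gcongr
      · exact integrable_torus (by simp only [trigSum_add]; fun_prop)
      · exact (integrable_torus (by fun_prop)).add (integrable_torus (by fun_prop))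
      · intro θ
        simpa only [trigSum_add] using abs_add_le (trigSum w θ) (trigSum v θ))
    fun r w => by
      simp only [trigSum_smul, abs_mul, integral_const_mul, Real.norm_eq_abs]
      ring

theorem trigSeminorm_apply (w : ι → ℂ) :
    trigSeminorm ι w = ((2 * Real.pi) ^ Fintype.card ι)⁻¹ * ∫ θ, |trigSum w θ| :=
  rfl

theorem trigSeminorm_eq_integral_cube (w : ι → ℂ) :
    trigSeminorm ι w = ((2 * Real.pi) ^ Fintype.card ι)⁻¹ *
      ∫ φ in Set.Icc (0 : ι → ℝ) (fun _ => 2 * Real.pi), |∑ i, ‖w i‖ * Real.cos (φ i)| := by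
  obtain ⟨α, hα⟩ := exists_mul_toCircle_eq_norm w
  have hrot : ∫ θ, |trigSum w θ| = ∫ θ, |trigSum (fun i => (‖w i‖ : ℂ)) θ| := by
    rw [← hα, ← integral_add_left_eq_self _ α]
    simp only [trigSum_mul_toCircle]
  rw [trigSeminorm_apply, hrot, ← integral_cube_eq_integral_torus (by fun_prop)]
  simp [trigSum_coe]

theorem im_eq_zero_of_trigSum_mul_nonneg {z : ι → ℝ} {v : ι → ℂ} (hz : 0 < ∑ i, z i)
    (hv : ∀ θ, 0 ≤ trigSum (fun i => (z i : ℂ)) θ * trigSum v θ) (i : ι) : (v i).im = 0 := by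
  -- As `s → 0⁺` the first sum is `sin s * ∑ i, z i > 0` and the second tends to
  -- `-∑ i, |(v i).im|`.
  set φ : ℝ → ι → ℝ := fun s i => if 0 ≤ (v i).im then Real.pi / 2 - s else -(Real.pi / 2 - s)
  have hcos : ∀ s i, Real.cos (φ s i) = Real.sin s := by
    intro s i
    simp only [φ]
    split_ifs <;> simp only [Real.cos_neg, Real.cos_pi_div_two_sub]
  have hsin : ∀ s i, (v i).im * Real.sin (φ s i) = |(v i).im| * Real.cos s := by
    intro s i
    simp only [φ]
    split_ifs with hi
    · rw [abs_of_nonneg hi, Real.sin_pi_div_two_sub]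
    · rw [abs_of_neg (not_le.1 hi), Real.sin_neg, Real.sin_pi_div_two_sub]
      ring
  have hpos : ∀ᶠ s in nhdsWithin (0 : ℝ) (Set.Ioi 0),
      0 ≤ (∑ i, (v i).re) * Real.sin s - (∑ i, |(v i).im|) * Real.cos s := by
    filter_upwards [Ioo_mem_nhdsGT Real.pi_pos] with s hs
    have hs := Real.sin_pos_of_mem_Ioo hs
    have hφ := hv fun i => (φ s i : AddCircle (2 * Real.pi))
    simp only [trigSum_coe, Complex.ofReal_re, Complex.ofReal_im, zero_mul, sub_zero, hcos, hsin,
      Finset.sum_sub_distrib, ← Finset.sum_mul] at hφ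
    exact nonneg_of_mul_nonneg_right hφ (mul_pos hz hs)
  have hlim : Filter.Tendsto
      (fun s => (∑ i, (v i).re) * Real.sin s - (∑ i, |(v i).im|) * Real.cos s)
      (nhdsWithin (0 : ℝ) (Set.Ioi 0)) (nhds (-∑ i, |(v i).im|)) :=
    (Continuous.tendsto' (by fun_prop) 0 _ (by simp)).mono_left nhdsWithin_le_nhds
  have hle := ge_of_tendsto hlim hpos
  have hzero := (Fintype.sum_eq_zero_iff_of_nonneg fun i => abs_nonneg (v i).im).1
    (le_antisymm (neg_nonneg.1 hle) (Finset.sum_nonneg fun i _ => abs_nonneg _))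
  exact abs_eq_zero.1 (congrFun hzero i)

theorem sameRay_of_cos_mul_nonneg {z a : ι → ℝ}
    (hza : ∀ φ : ι → ℝ, 0 ≤ (∑ i, z i * Real.cos (φ i)) * ∑ i, a i * Real.cos (φ i)) :
    SameRay ℝ z a := by
  classical
  refine (Function.Injective.sameRay_map_iff
    (LinearEquiv.injective (dotProductEquiv ℝ ι))).1 (sameRay_of_forall_mul_nonneg fun c => ?_)
  have hN : 0 < 1 + ‖c‖ := by positivity
  have hcos : ∀ i, Real.cos (Real.arccos (c i / (1 + ‖c‖))) = c i / (1 + ‖c‖) := by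
    intro i
    have hi : |c i / (1 + ‖c‖)| ≤ 1 := by
      rw [abs_div, abs_of_pos hN, div_le_one hN]
      exact (norm_le_pi_norm c i).trans (by linarith)
    exact Real.cos_arccos (abs_le.1 hi).1 (abs_le.1 hi).2
  have hscaled := hza fun i => Real.arccos (c i / (1 + ‖c‖))
  simp only [hcos, ← mul_div_assoc, ← Finset.sum_div] at hscaled
  rwa [div_mul_eq_mul_div, div_div, le_div_iff₀ (mul_pos hN hN), zero_mul] at hscaled

theorem sameRay_of_trigSum_mul_nonneg {w v : ι → ℂ}
    (hwv : ∀ θ, 0 ≤ trigSum w θ * trigSum v θ) : SameRay ℝ w v := by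
  rcases eq_or_ne w 0 with rfl | hw
  · exact SameRay.zero_left _
  obtain ⟨α, hα⟩ := exists_mul_toCircle_eq_norm w
  set rot : (ι → ℂ) →ₗ[ℝ] ι → ℂ :=
    LinearMap.mulRight ℝ fun i => (AddCircle.toCircle (α i) : ℂ)
  have hrot : Function.Injective rot := fun u u' huu => funext fun i =>
    mul_right_cancel₀ (Circle.coe_ne_zero _) (congrFun huu i)
  have hrotw : rot w = fun i => (‖w i‖ : ℂ) := hα
  have hprod : ∀ θ, 0 ≤ trigSum (fun i => (‖w i‖ : ℂ)) θ * trigSum (rot v) θ := by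
    intro θ
    rw [← hα, trigSum_mul_toCircle]
    exact (hwv (α + θ)).trans_eq (congrArg _ (trigSum_mul_toCircle v α θ).symm)
  have hsum : 0 < ∑ i, ‖w i‖ := by
    obtain ⟨i, hi⟩ := Function.ne_iff.1 hw
    exact Finset.sum_pos' (fun i _ => norm_nonneg _) ⟨i, Finset.mem_univ i, norm_pos_iff.2 hi⟩
  have hreal : rot v = fun i => ((rot v i).re : ℂ) := funext fun i =>
    Complex.ext rfl (im_eq_zero_of_trigSum_mul_nonneg hsum hprod i)
  have hray : SameRay ℝ (fun i => ‖w i‖) fun i => (rot v i).re := by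
    refine sameRay_of_cos_mul_nonneg fun φ => ?_
    have hφ := hprod fun i => (φ i : AddCircle (2 * Real.pi))
    rw [hreal] at hφ
    simpa [trigSum_coe] using hφ
  rw [← Function.Injective.sameRay_map_iff hrot, hrotw, hreal]
  exact hray.map (Complex.ofRealCLM.toLinearMap.compLeft ι)

theorem isStrictlyConvex_trigSeminorm : IsStrictlyConvex (trigSeminorm ι) := by
  intro w v hwv
  refine sameRay_of_trigSum_mul_nonneg fun θ => ?_
  have hcont : Continuous fun θ => |trigSum w θ| + |trigSum v θ| - |trigSum w θ + trigSum v θ| := by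
    fun_prop
  have hint : ∫ θ, (|trigSum w θ| + |trigSum v θ| - |trigSum w θ + trigSum v θ|) = 0 := by
    rw [integral_sub (integrable_torus (by fun_prop)) (integrable_torus (by fun_prop)),
      integral_add (integrable_torus (by fun_prop)) (integrable_torus (by fun_prop)), sub_eq_zero]
    simp only [trigSeminorm_apply, trigSum_add, ← mul_add] at hwv
    exact (mul_left_cancel₀ (by positivity) hwv).symm
  rw [integral_eq_zero_iff_of_nonneg (fun θ => sub_nonneg.2 (abs_add_le _ _))
    (integrable_torus hcont), hcont.ae_eq_iff_eq _ continuous_zero] at hint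
  rcases (abs_add_eq_add_abs_iff _ _).1 (sub_eq_zero.1 (congrFun hint θ)).symm with hθ | hθ
  · exact mul_nonneg hθ.1 hθ.2
  · exact mul_nonneg_of_nonpos_of_nonpos hθ.1 hθ.2

end TrigonometricSums

variable {n : ℕ} {ω : Fin n → ℝ}

/-- The vector with components `ηᵢ + i ωᵢ⁻¹ ξᵢ`, whose moduli are the amplitudes `zᵢ` of `p`. -/
noncomputable def complexAmplitude (ω : Fin n → ℝ) : Phase n →ₗ[ℝ] Fin n → ℂ where
  toFun p i := ⟨p (1, i), (ω i)⁻¹ * p (0, i)⟩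
  map_add' p q := funext fun i => Complex.ext (by simp) (by simp [mul_add])
  map_smul' r p := funext fun i => Complex.ext (by simp) (by simp [mul_left_comm])

theorem norm_complexAmplitude (ω : Fin n → ℝ) (p : Phase n) (i : Fin n) :
    ‖complexAmplitude ω p i‖ = amplitude ω p i := by
  rw [Complex.norm_eq_sqrt_sq_add_sq, amplitude]
  simp [complexAmplitude, mul_pow]

theorem injective_complexAmplitude (hω : ∀ i, ω i ≠ 0) :
    Function.Injective (complexAmplitude ω) := by
  intro p q hpq
  ext ⟨k, i⟩
  have hi := Complex.ext_iff.1 (congrFun hpq i)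
  fin_cases k
  · exact mul_left_cancel₀ (inv_ne_zero (hω i)) hi.2
  · exact hi.1

/-- `H_Ω` as a seminorm. -/
noncomputable def supportSeminorm (ω : Fin n → ℝ) : Seminorm ℝ (Phase n) :=
  (trigSeminorm (Fin n)).comp (complexAmplitude ω)

theorem coe_supportSeminorm (ω : Fin n → ℝ) : ⇑(supportSeminorm ω) = supportFn ω := by
  ext p
  rw [supportSeminorm, Seminorm.comp_apply, trigSeminorm_eq_integral_cube, Fintype.card_fin]
  simp only [norm_complexAmplitude, supportFn]

theorem isStrictlyConvex_supportSeminorm (hω : ∀ i, ω i ≠ 0) :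
    IsStrictlyConvex (supportSeminorm ω) :=
  isStrictlyConvex_trigSeminorm.comp (injective_complexAmplitude hω)

theorem gauge_dualBody_supportSeminorm (ω : Fin n → ℝ) :
    gauge (dualBody (supportSeminorm ω)) = rho ω := by
  ext x
  rw [rho, body, dualBody, coe_supportSeminorm]

theorem toEuclideanLin_matA_apply_zero (ω : Fin n → ℝ) (x : Phase n) (i : Fin n) :
    Matrix.toEuclideanLin (matA ω) x (0, i) = x (1, i) := by
  simp [matA, Matrix.toLpLin_apply, Matrix.mulVec, dotProduct, Fintype.sum_prod_type,
    Matrix.blockDiagonal_apply, Fin.sum_univ_two]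

theorem toEuclideanLin_matA_apply_one (ω : Fin n → ℝ) (x : Phase n) (i : Fin n) :
    Matrix.toEuclideanLin (matA ω) x (1, i) = -ω i ^ 2 * x (0, i) := by
  simp [matA, Matrix.toLpLin_apply, Matrix.mulVec, dotProduct, Fintype.sum_prod_type,
    Matrix.blockDiagonal_apply, Fin.sum_univ_two]

theorem adjoint_toEuclideanLin_matA_apply_zero (ω : Fin n → ℝ) (p : Phase n) (i : Fin n) :
    LinearMap.adjoint (Matrix.toEuclideanLin (matA ω)) p (0, i) = -ω i ^ 2 * p (1, i) := by
  rw [← Matrix.toEuclideanLin_conjTranspose_eq_adjoint]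
  simp [matA, Matrix.toLpLin_apply, Matrix.mulVec, dotProduct, Fintype.sum_prod_type,
    Matrix.blockDiagonal_apply, Fin.sum_univ_two]

theorem adjoint_toEuclideanLin_matA_apply_one (ω : Fin n → ℝ) (p : Phase n) (i : Fin n) :
    LinearMap.adjoint (Matrix.toEuclideanLin (matA ω)) p (1, i) = p (0, i) := by
  rw [← Matrix.toEuclideanLin_conjTranspose_eq_adjoint]
  simp [matA, Matrix.toLpLin_apply, Matrix.mulVec, dotProduct, Fintype.sum_prod_type,
    Matrix.blockDiagonal_apply, Fin.sum_univ_two]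

theorem amplitude_adjointFlow (hω : ∀ i, ω i ≠ 0) (t : ℝ) (p : Phase n) (i : Fin n) :
    amplitude ω (adjointFlow (Matrix.toEuclideanLin (matA ω)) t p) i = amplitude ω p i := by
  set q := fun s => adjointFlow (Matrix.toEuclideanLin (matA ω)) s p
  have hcoord : ∀ k s, HasDerivAt (fun s => q s k)
      (-LinearMap.adjoint (Matrix.toEuclideanLin (matA ω)) (q s) k) s := fun k s =>
    (EuclideanSpace.proj (𝕜 := ℝ) k).hasFDerivAt.comp_hasDerivAt s (hasDerivAt_adjointFlow p s)
  have henergy : ∀ s, HasDerivAt (fun s => q s (1, i) ^ 2 + (ω i ^ 2)⁻¹ * q s (0, i) ^ 2) 0 s := by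
    intro s
    refine (((hcoord (1, i) s).fun_pow 2).add
      (((hcoord (0, i) s).fun_pow 2).const_mul _)).congr_deriv ?_
    rw [adjoint_toEuclideanLin_matA_apply_zero, adjoint_toEuclideanLin_matA_apply_one]
    have := hω i
    field_simp
    ring
  have hconst := is_const_of_deriv_eq_zero (fun s => (henergy s).differentiableAt)
    (fun s => (henergy s).deriv) t 0
  simp only [q, adjointFlow_zero] at hconst
  rw [amplitude, amplitude, hconst]

theorem supportSeminorm_adjointFlow (hω : ∀ i, ω i ≠ 0) (t : ℝ) (p : Phase n) :
    supportSeminorm ω (adjointFlow (Matrix.toEuclideanLin (matA ω)) t p) = supportSeminorm ω p := by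
  simp only [coe_supportSeminorm, supportFn, amplitude_adjointFlow hω]

theorem toEuclideanLin_matA_sq_pow_apply (ω : Fin n → ℝ) (m : ℕ) (x : Phase n) (k : Fin 2)
    (i : Fin n) :
    (Matrix.toEuclideanLin (matA ω) ^ (2 * m)) x (k, i) = (-ω i ^ 2) ^ m * x (k, i) := by
  induction m generalizing x with
  | zero => simp
  | succ m ih =>
    rw [mul_add, mul_one, pow_add, Module.End.mul_apply, ih,
      pow_two (Matrix.toEuclideanLin (matA ω)), Module.End.mul_apply]
    fin_cases k
    · simp only [Fin.zero_eta, toEuclideanLin_matA_apply_zero, toEuclideanLin_matA_apply_one]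
      ring
    · simp only [Fin.mk_one, toEuclideanLin_matA_apply_zero, toEuclideanLin_matA_apply_one]
      ring

theorem isControllable_of_injective_sq (hω : Function.Injective fun i => ω i ^ 2) :
    IsControllable (Matrix.toEuclideanLin (matA ω)) (vecB n) := by
  intro p hp
  have hinj : Function.Injective fun i => -ω i ^ 2 := neg_injective.comp hω
  have heven : ∀ m : ℕ, ∑ i, p (1, i) * (-ω i ^ 2) ^ m = 0 := fun m => by
    rw [← hp (2 * m)]
    simp only [PiLp.inner_apply, Fintype.sum_prod_type, Fin.sum_univ_two,
      toEuclideanLin_matA_sq_pow_apply]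
    simp [vecB, mul_comm]
  have hodd : ∀ m : ℕ, ∑ i, p (0, i) * (-ω i ^ 2) ^ m = 0 := fun m => by
    rw [← hp (2 * m + 1), pow_succ, Module.End.mul_apply]
    simp only [PiLp.inner_apply, Fintype.sum_prod_type, Fin.sum_univ_two,
      toEuclideanLin_matA_sq_pow_apply, toEuclideanLin_matA_apply_zero,
      toEuclideanLin_matA_apply_one]
    simp [vecB, mul_comm]
  have hη := Matrix.eq_zero_of_forall_pow_sum_mul_pow_eq_zero hinj (v := fun i => p (1, i))
    fun m => heven m
  have hξ := Matrix.eq_zero_of_forall_pow_sum_mul_pow_eq_zero hinj (v := fun i => p (0, i))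
    fun m => hodd m
  ext ⟨k, i⟩
  fin_cases k
  · exact congrFun hξ i
  · exact congrFun hη i

theorem exists_isNormal_of_mem_feedback (hω : ∀ i, ω i ≠ 0) {x : Phase n} (hx : 0 < rho ω x)
    {u : ℝ} (hu : u ∈ feedback ω x) :
    ∃ p, |u| ≤ 1 ∧ IsNormal (supportSeminorm ω) x p ∧
      u * inner ℝ p (vecB n) = -|inner ℝ p (vecB n)| := by
  obtain ⟨p, ⟨hp0, hp⟩, hu, hsign⟩ := hu
  have hpos := (isStrictlyConvex_supportSeminorm hω).pos hp0
  rw [← coe_supportSeminorm] at hp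
  have heuler := apply_self_of_hasFDerivAt_seminorm hp.hasFDerivAt
  rw [InnerProductSpace.toDual_apply_apply, real_inner_comm, inner_smul_right, inv_mul_eq_div,
    div_eq_iff hx.ne'] at heuler
  refine ⟨(supportSeminorm ω p)⁻¹ • p, hu, ⟨?_, ?_⟩, ?_⟩
  · rw [map_smul_eq_mul, norm_inv, Real.norm_of_nonneg hpos.le, inv_mul_cancel₀ hpos.ne']
  · rw [real_inner_smul_left, heuler, inv_mul_cancel_left₀ hpos.ne',
      gauge_dualBody_supportSeminorm]
  · have hfriction : u * inner ℝ p (vecB n) = -|inner ℝ p (vecB n)| := by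
      rw [real_inner_comm]
      rcases lt_trichotomy (inner ℝ (vecB n) p) 0 with hneg | hzero | hpos
      · rw [hsign hneg.ne, Real.sign_of_neg hneg, abs_of_neg hneg]; ring
      · simp [hzero]
      · rw [hsign hpos.ne', Real.sign_of_pos hpos, abs_of_pos hpos]; ring
    rw [real_inner_smul_left, abs_mul, abs_of_pos (inv_pos.2 hpos), mul_left_comm, hfriction,
      mul_neg]

theorem IsMotion.isFrictionMotion (hω : ∀ i, ω i ≠ 0) {a c : ℝ} {x : ℝ → Phase n}
    (hx : IsMotion ω a c x) (hpos : ∀ t ∈ Set.Icc a c, 0 < rho ω (x t)) :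
    IsFrictionMotion (supportSeminorm ω) (Matrix.toEuclideanLin (matA ω)) (vecB n) a c x := by
  refine ⟨hx.1, ?_⟩
  filter_upwards [hx.2] with t ht htac
  obtain ⟨u, hu, hxt⟩ := ht htac
  obtain ⟨p, hu, hp, hup⟩ :=
    exists_isNormal_of_mem_feedback hω (hpos t (Set.Ioo_subset_Icc_self htac)) hu
  exact ⟨u, p, hu, hp, hup, hxt⟩

theorem NonResonant.linearIndependent (hω : NonResonant ω) : LinearIndependent ℤ ω :=
  Fintype.linearIndependent_iff.2 fun m hm =>
    congrFun (hω m (by simpa only [zsmul_eq_mul] using hm))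

theorem NonResonant.injective_sq (hω : NonResonant ω) : Function.Injective fun i => ω i ^ 2 := by
  intro i j hij
  rcases sq_eq_sq_iff_eq_or_eq_neg.1 hij with h | h
  · exact hω.linearIndependent.injective h
  · by_contra hne
    refine hω.linearIndependent.notMem_span_image (s := {j}) (x := i) hne ?_
    simp [h]

end Oscillators

theorem theorem2_general (n : ℕ) (ω : Fin n → ℝ) (hω : ∀ i, ω i ≠ 0)
    (hinj : Function.Injective fun i => ω i ^ 2) :
    ∃ C c : ℝ, 0 < C ∧ 0 < c ∧
      ∀ (x : ℝ → Oscillators.Phase n) (a T : ℝ), 0 ≤ T → Oscillators.IsMotion ω a (a + T) x →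
        (∀ t ∈ Set.Icc a (a + T), C ≤ Oscillators.rho ω (x t)) →
        ⌊T⌋₊ ≤ c * (Oscillators.rho ω (x a) - Oscillators.rho ω (x (a + T))) := by
  obtain ⟨C, hC, κ, hκ, hdecay⟩ :=
    (Oscillators.isControllable_of_injective_sq hinj).exists_floor_mul_le
      (Oscillators.isStrictlyConvex_supportSeminorm hω) (Oscillators.supportSeminorm_adjointFlow hω)
  rw [Oscillators.gauge_dualBody_supportSeminorm] at hdecay
  refine ⟨C, κ⁻¹, hC, inv_pos.2 hκ, fun x a T hT hx hlarge => ?_⟩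
  rw [inv_mul_eq_div, le_div_iff₀ hκ]
  exact hdecay x a T hT (hx.isFrictionMotion hω fun t ht => hC.trans_le (hlarge t ht)) hlarge

theorem theorem2 (n : ℕ) (ω : Fin n → ℝ) (hω : Oscillators.NonResonant ω) :
    ∃ C c : ℝ, 0 < C ∧ 0 < c ∧
      ∀ (x : ℝ → Oscillators.Phase n) (a : ℝ) (T : ℕ) (M N : ℝ),
        Oscillators.IsMotion ω a (a + T) x →
        (∀ t ∈ Set.Icc a (a + T), C ≤ Oscillators.rho ω (x t)) →
        Oscillators.rho ω (x a) = M →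
        Oscillators.rho ω (x (a + T)) = N →
        (T : ℝ) ≤ c * (M - N) := by
  obtain ⟨C, c, hC, hc, hdecay⟩ :=
    theorem2_general n ω hω.linearIndependent.ne_zero hω.injective_sq
  refine ⟨C, c, hC, hc, fun x a T M N hx hlarge hM hN => ?_⟩
  simpa only [Nat.floor_natCast, hM, hN] using hdecay x a T T.cast_nonneg hx hlarge
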